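/- All rings are commutative with unit. For a ring homomorphism $f:A\to B$ and an ideal $I$ of $A[x_1,\ldots,x_n]$, let $\mathscr Z_f(I)\subseteq B^n$ be the set of the points of $B^n$ at which all the polynomials of $I$, with coefficients mapped through $f$, vanish, and let $\mathscr Z(I)=\mathscr Z_{\mathrm{id}_A}(I)\subseteq A^n$. The homomorphism $f$ is called (positively) existentially closed if for every $n\geq 0$ and every finitely generated ideal $I$ of $A[x_1,\ldots,x_n]$ such that $\mathscr Z_f(I)\neq\emptyset$, one has $\mathscr Z(I)\neq\emptyset$. If $\mathcal C$ is a full subcategory of the category of rings, a ring $A$ is called existentially closed in $\mathcal C$ if $A$ is in $\mathcal C$ and every ring homomorphism from $A$ to a ring in $\mathcal C$ is existentially closed. A pre-real ring is a ring in which $-1$ is not a sum of squares ($0$ being the empty sum, such a ring is nontrivial). A real field is a field in which $-1$ is not a sum of squares. A real closed field is a real field $k$ such that for every $a\in k$ one of $a$, $-a$ is a square in $k$, and such that every polynomial of odd degree in one variable over $k$ has a root in $k$ (equivalently, a real field with no proper real algebraic extension). **Corollary.** Let $A$ be a ring. 1. $A$ is existentially closed in the category of pre-real rings if and only if $A$ is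 a real closed field. 2. $A$ is a real closed field if and only if $A$ is existentially closed in the category of real fields. -/

import Mathlib

universe u v

/-- The set `𝒵_f(I)` of the zeros in `B^n`, through `f : A →+* B`, of an ideal `I` of
`A[x₁, …, xₙ]`. For `f = RingHom.id A` this is the zero set `𝒵(I)` of `I` in `A^n`. -/
def zerosThrough {A : Type u} {B : Type v} [CommRing A] [CommRing B] (f : A →+* B) {n : ℕ}
    (I : Ideal (MvPolynomial (Fin n) A)) : Set (Fin n → B) :=
  {b | ∀ p ∈ I, MvPolynomial.eval₂ f b p = 0}

/-- A ring homomorphism `f : A →+* B` is (positively) existentially closed if every finitely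
generated ideal of a polynomial ring in finitely many variables over `A` that has a zero in `B`
through `f` has a zero in `A`. -/
def IsExistentiallyClosedHom {A : Type u} {B : Type v} [CommRing A] [CommRing B]
    (f : A →+* B) : Prop :=
  ∀ (n : ℕ) (I : Ideal (MvPolynomial (Fin n) A)), I.FG →
    (zerosThrough f I).Nonempty → (zerosThrough (RingHom.id A) I).Nonempty

/-- A ring `A` is (positively) existentially closed in a full subcategory `C` of commutative rings
(given by the predicate that cuts out its objects) if it is in `C` and every ring homomorphism from
`A` to a ring in `C` is existentially closed. -/
structure IsExistentiallyClosedIn (C : ∀ (B : Type u) [CommRing B], Prop)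
    (A : Type u) [CommRing A] : Prop where
  mem : C A
  isExistentiallyClosedHom :
    ∀ (B : Type u) [CommRing B], C B → ∀ f : A →+* B, IsExistentiallyClosedHom f

/-- A pre-real ring: a commutative ring in which `-1` is not a sum of squares. The empty sum counts,
so a pre-real ring is nontrivial. -/
def IsPreRealRing (A : Type u) [CommRing A] : Prop :=
  ¬ IsSumSq (-1 : A)

/-- A real field: a field in which `-1` is not a sum of squares. -/
def IsRealField (A : Type u) [CommRing A] : Prop :=
  IsField A ∧ ¬ IsSumSq (-1 : A)

/-- The commutative ring `A` is a real closed field. -/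
def IsRealClosedField (A : Type u) [CommRing A] : Prop :=
  ∃ h : IsField A, @IsRealClosed A h.toField

/-!
The central point is that a homomorphism `f : k →+* B` from a real closed field to a
pre-real ring is existentially closed.

A maximal preordering of `B` is an ordering (`RingPreordering.isOrdering_of_isMax`), so `B` maps to
a real field, the residue field of its support, and a real field embeds into a real closed field `R`
(`exists_ringHom_isRealClosed`). Since `f` is existentially closed as soon as its composite with
`B →+* R` is, it may be assumed that `B = R` is real closed. The coordinates of a zero in `R` lie in
a tower of relatively algebraically closed, hence real closed, subfields of `R`, each algebraic over
a simple transcendental extension of the preceding one, and existentially closed homomorphisms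
compose. This leaves an extension `M ⊆ N` of real closed fields with `N` algebraic over `M(x)`.

The sign at `x` of a polynomial over `M` is its sign at each point of `M` that is on the same side
as `x` of all the roots, by the intermediate value theorem in `N`. Hence the ordered field `M(x)`
embeds over `M` into an ultrapower `M*` of `M` (`IsRealClosed.exists_ringHom_germ`). The field `M*`
is real closed, and the finite extension `L` of `M(x)` generated by the zero also embeds into `M*`:
if an ordered field `K` has real closed extensions `R` and `R'`, the number of `K`-embeddings of `L`
into `R` is the signature of the trace form of `L`, which depends on the ordering of `K` only
(`nonempty_algHom_of_algHom`; it is enough to bound the numbers of positive and negative diagonal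
entries). So the system has a zero in `M*`, and then in `M` because `M → M*` is existentially closed
(`isExistentiallyClosedHom_germ`).

Two facts about a real closed field `R` are used throughout: `R[i]` is algebraically closed, by
Galois theory and Sylow's theorem (`IsRealClosed.isAlgClosed_adjoinI`), and consequently `R` has no
proper algebraic real extension.

For the converse implications, a ring with an existentially closed homomorphism to a field is a
field, and a real field that is existentially closed in real fields contains a root of each
irreducible `p` for which `A[X] / (p)` is real, which forces it to be real closed
(`IsRealClosed.of_forall_adjoinRoot`).
-/

/-! ### The order of a real closed field -/

namespace IsRealClosed

open Polynomial

theorem isSquare_of_isSumSq {R : Type*} [Field R] [IsRealClosed R] {x : R} (hx : IsSumSq x) :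
    IsSquare x := by
  rcases isSquare_or_isSquare_neg x with h | ⟨c, hc⟩
  · exact h
  by_cases h0 : c = 0
  · have : x = 0 := by simpa [h0] using hc
    simp [this]
  · refine absurd ?_ (IsSemireal.not_isSumSq_neg_one R)
    have : (-1 : R) = x * (c⁻¹ * c⁻¹) := by
      field_simp
      linear_combination hc
    rw [this]
    exact hx.mul (IsSumSq.mul_self _)

/-- A real closed field has a field ordering, the nonnegative elements being the squares. -/
theorem exists_linearOrder (R : Type*) [Field R] [IsRealClosed R] :
    ∃ _ : LinearOrder R, IsStrictOrderedRing R := by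
  classical
  have hadd {x y : R} (hx : IsSquare x) (hy : IsSquare y) : IsSquare (x + y) :=
    isSquare_of_isSumSq (hx.isSumSq.add hy.isSumSq)
  have hanti {x : R} (hx : IsSquare x) (hy : IsSquare (-x)) : x = 0 := by
    obtain ⟨c, rfl⟩ := hx
    by_contra h0
    refine IsSemireal.not_isSumSq_neg_one R ?_
    have hc : c ≠ 0 := by rintro rfl; simp at h0
    have : (-1 : R) = -(c * c) * (c⁻¹ * c⁻¹) := by field_simp
    rw [this]
    exact (hy.isSumSq).mul (IsSumSq.mul_self _)
  let ord : LinearOrder R :=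
    { le := fun a b => IsSquare (b - a)
      le_refl := fun a => by simp
      le_trans := fun a b c hab hbc => by
        rw [show c - a = (b - a) + (c - b) by ring]
        exact hadd hab hbc
      le_antisymm := fun a b hab hba => by
        have := hanti hab (by rw [neg_sub]; exact hba)
        exact (sub_eq_zero.1 this).symm
      le_total := fun a b => by
        have := isSquare_or_isSquare_neg (b - a)
        rwa [neg_sub] at this
      toDecidableLE := Classical.decRel _ }
  have hle (a b : R) : a ≤ b ↔ IsSquare (b - a) := Iff.rfl
  have : IsOrderedAddMonoid R :=
    { add_le_add_left := fun a b h c => by rw [hle] at h ⊢; simpa using h }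
  have : ZeroLEOneClass R := ⟨by rw [hle]; simp⟩
  refine ⟨ord, IsStrictOrderedRing.of_mul_pos fun a b ha hb => ?_⟩
  refine lt_of_le_of_ne ?_ (mul_ne_zero ha.ne' hb.ne').symm
  have ha' := (hle _ _).1 ha.le
  have hb' := (hle _ _).1 hb.le
  rw [sub_zero] at ha' hb'
  rw [hle, sub_zero]
  exact ha'.mul hb'

end IsRealClosed

/-! ### The field obtained by adjoining a square root of `-1` -/

/-- The algebra `R[i]` with `i ^ 2 = -1`; it is a field when `-1` is not a square in `R`. -/
abbrev AdjoinI (R : Type*) [CommRing R] : Type _ := QuadraticAlgebra R (-1) 0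

instance IsSemireal.fact_sq_ne {R : Type*} [Field R] [IsSemireal R] :
    Fact (∀ r : R, r ^ 2 ≠ -1 + 0 * r) :=
  ⟨fun r h => IsSemireal.not_isSumSq_neg_one R (by
    rw [show (-1 : R) = r * r by linear_combination -h]
    exact IsSumSq.mul_self r)⟩

namespace IsRealClosed

open Polynomial

theorem isSquare_adjoinI {R : Type*} [Field R] [IsRealClosed R] (z : AdjoinI R) :
    IsSquare z := by
  obtain ⟨_, _⟩ := exists_linearOrder R
  obtain ⟨a, b⟩ := z
  obtain ⟨r, hr0, hr⟩ : ∃ r : R, 0 ≤ r ∧ r * r = a * a + b * b := by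
    obtain ⟨r, hr⟩ := IsSquare.of_nonneg (add_nonneg (mul_self_nonneg a) (mul_self_nonneg b))
    exact ⟨|r|, abs_nonneg r, by rw [abs_mul_abs_self, hr]⟩
  have hle : |a| ≤ r := abs_le_of_sq_le_sq (by nlinarith [mul_self_nonneg b]) hr0
  obtain ⟨h1, h2⟩ := abs_le.1 hle
  obtain ⟨x, hx⟩ := IsSquare.of_nonneg (show 0 ≤ (r + a) / 2 by linarith)
  obtain ⟨y, hy⟩ := IsSquare.of_nonneg (show 0 ≤ (r - a) / 2 by linarith)
  have hxy : (2 * x * y) ^ 2 = b ^ 2 := by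
    have : (2 * x * y) ^ 2 = 4 * (x * x) * (y * y) := by ring
    rw [this, ← hx, ← hy]
    linear_combination hr
  rcases sq_eq_sq_iff_eq_or_eq_neg.1 hxy with h | h
  · refine ⟨⟨x, y⟩, ?_⟩
    ext
    · simp only [QuadraticAlgebra.mk_mul_mk]; linear_combination hx - hy
    · simp only [QuadraticAlgebra.mk_mul_mk]; linear_combination -h
  · refine ⟨⟨x, -y⟩, ?_⟩
    ext
    · simp only [QuadraticAlgebra.mk_mul_mk]; linear_combination hx - hy
    · simp only [QuadraticAlgebra.mk_mul_mk]; linear_combination h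

/-- A real closed field has no proper extension of odd degree. -/
theorem finrank_eq_one_of_odd {R D : Type*} [Field R] [IsRealClosed R] [Field D] [Algebra R D]
    [FiniteDimensional R D] (h : Odd (Module.finrank R D)) : Module.finrank R D = 1 := by
  obtain ⟨α, hα⟩ := Field.exists_primitive_element R D
  have hd := (Field.primitive_element_iff_minpoly_natDegree_eq R α).1 hα
  have hint : IsIntegral R α := Algebra.IsIntegral.isIntegral α
  obtain ⟨x, hx⟩ := exists_isRoot_of_odd_natDegree (f := minpoly R α) (hd ▸ h)
  rw [← hd]
  exact natDegree_eq_of_degree_eq_some (degree_eq_one_of_irreducible_of_root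
    (minpoly.irreducible hint) hx)

theorem finrank_ne_two_of_forall_isSquare {C D : Type*} [Field C] [NeZero (2 : C)] [Field D]
    [Algebra C D] (hC : ∀ z : C, IsSquare z) : Module.finrank C D ≠ 2 := by
  intro h
  have : FiniteDimensional C D := FiniteDimensional.of_finrank_pos (by omega)
  -- any element outside `C` generates `D` and is a root of a quadratic polynomial
  have hne : (⊥ : Subalgebra C D) ≠ ⊤ := fun h' => by
    have := Subalgebra.bot_eq_top_iff_finrank_eq_one.1 h'
    omega
  obtain ⟨z, -, hz⟩ := SetLike.exists_of_lt hne.lt_top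
  have hint : IsIntegral C z := Algebra.IsIntegral.isIntegral z
  have hdvd : (minpoly C z).natDegree ∣ 2 := h ▸ minpoly.degree_dvd hint
  have hdeg : (minpoly C z).natDegree = 2 := by
    rcases (Nat.dvd_prime Nat.prime_two).1 hdvd with h1 | h2
    · exact absurd (minpoly.natDegree_eq_one_iff.1 h1) (by simpa [Algebra.mem_bot] using hz)
    · exact h2
  obtain ⟨s, hs⟩ := hC (discrim 1 ((minpoly C z).coeff 1) ((minpoly C z).coeff 0))
  obtain ⟨x, hx⟩ := exists_quadratic_eq_zero one_ne_zero ⟨s, hs⟩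
  have hroot : (minpoly C z).IsRoot x := by
    have hlead : (minpoly C z).coeff 2 = 1 := by
      rw [← hdeg]; exact minpoly.monic hint
    rw [IsRoot.def, eval_eq_sum_range, hdeg]
    simp only [Finset.sum_range_succ, Finset.range_zero, Finset.sum_empty, hlead]
    linear_combination hx
  have : (minpoly C z).natDegree = 1 := natDegree_eq_of_degree_eq_some
    (degree_eq_one_of_irreducible_of_root (minpoly.irreducible hint) hroot)
  omega

/-- If `E` is Galois over the real closed field `R` and contains a subfield `C` all of whose
elements are squares, then `E = C`: the Galois group of `E` over `R` is a `2`-group, since its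
Sylow subgroup cuts out an extension of odd degree, so a proper extension `E` of `C` would contain a
quadratic extension of `C`. -/
theorem finrank_eq_one_of_isGalois {R C E : Type*} [Field R] [IsRealClosed R] [Field C] [Field E]
    [Algebra R C] [Algebra R E] [Algebra C E] [IsScalarTower R C E] [FiniteDimensional R E]
    [IsGalois R E] (hC : ∀ z : C, IsSquare z) : Module.finrank C E = 1 := by
  have : FiniteDimensional C E := FiniteDimensional.right R C E
  have : FiniteDimensional R C := FiniteDimensional.left R C E
  have : IsGalois C E := IsGalois.tower_top_of_isGalois R C E
  have : CharZero C := charZero_of_injective_algebraMap (algebraMap R C).injective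
  -- the order of the Galois group over `R` is a power of `2`
  have hpow : ∃ m, Module.finrank R E = 2 ^ m := by
    have P : Sylow 2 Gal(E/R) := default
    have hodd : Odd (Module.finrank R (IntermediateField.fixedField (P : Subgroup Gal(E/R)))) := by
      rw [IntermediateField.finrank_eq_fixingSubgroup_index,
        IntermediateField.fixingSubgroup_fixedField]
      have := P.not_dvd_index
      rwa [Nat.two_dvd_ne_zero, ← Nat.odd_iff] at this
    have h1 := finrank_eq_one_of_odd hodd
    obtain ⟨m, hm⟩ := P.isPGroup'.exists_card_eq
    refine ⟨m, ?_⟩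
    rw [← hm, ← Module.finrank_mul_finrank R (IntermediateField.fixedField
      (P : Subgroup Gal(E/R))) E, h1, one_mul, IntermediateField.finrank_fixedField_eq_card]
  obtain ⟨m, hm⟩ := hpow
  have hdvd : Module.finrank C E ∣ 2 ^ m := hm ▸ ⟨_, by
    rw [mul_comm]; exact (Module.finrank_mul_finrank R C E).symm⟩
  obtain ⟨l, -, hl⟩ := (Nat.dvd_prime_pow Nat.prime_two).1 hdvd
  rcases l with _ | l
  · simpa using hl
  · exfalso
    have hcard : Nat.card Gal(E/C) = 2 ^ (l + 1) := by rw [IsGalois.card_aut_eq_finrank, hl]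
    obtain ⟨H, hH⟩ := Sylow.exists_subgroup_card_pow_prime (G := Gal(E/C)) 2 (n := l)
      (hcard ▸ pow_dvd_pow 2 (Nat.le_succ l))
    refine finrank_ne_two_of_forall_isSquare (D := IntermediateField.fixedField H) hC ?_
    have h1 := Module.finrank_mul_finrank C (IntermediateField.fixedField H) E
    rw [IntermediateField.finrank_fixedField_eq_card, hH, hl, pow_succ'] at h1
    exact Nat.eq_of_mul_eq_mul_right (by positivity) h1

/-- The fundamental theorem of algebra over a real closed field. -/
instance isAlgClosed_adjoinI {R : Type*} [Field R] [IsRealClosed R] : IsAlgClosed (AdjoinI R) := by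
  refine IsAlgClosed.of_exists_root _ fun p hp hirr => ?_
  have := Fact.mk hirr
  let K := AdjoinRoot p
  have : FiniteDimensional (AdjoinI R) K := (AdjoinRoot.powerBasis hp.ne_zero).finite
  have : FiniteDimensional R K := FiniteDimensional.trans R (AdjoinI R) K
  let E := IntermediateField.normalClosure R K (AlgebraicClosure K)
  let : Algebra (AdjoinI R) E := ((algebraMap K E).comp (algebraMap (AdjoinI R) K)).toAlgebra
  have : IsScalarTower (AdjoinI R) K E := IsScalarTower.of_algebraMap_eq fun _ => rfl
  have : IsScalarTower R (AdjoinI R) E := IsScalarTower.of_algebraMap_eq fun x => by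
    rw [IsScalarTower.algebraMap_apply R K E]; rfl
  have h1 : Module.finrank (AdjoinI R) E = 1 :=
    finrank_eq_one_of_isGalois (R := R) isSquare_adjoinI
  have h2 := Module.finrank_mul_finrank (AdjoinI R) K E
  have h3 : Module.finrank (AdjoinI R) K = 1 := Nat.eq_one_of_mul_eq_one_right (h2.trans h1)
  have h4 : p.natDegree = 1 := by
    rw [← h3, (AdjoinRoot.powerBasis hp.ne_zero).finrank, AdjoinRoot.powerBasis_dim]
  exact exists_root_of_degree_eq_one (by rw [degree_eq_natDegree hp.ne_zero, h4]; rfl)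

end IsRealClosed

/-! ### Polynomials over a real closed field -/

theorem IsSumSq.map {A B F : Type*} [CommSemiring A] [CommSemiring B] [FunLike F A B]
    [RingHomClass F A B] (f : F) {a : A} (h : IsSumSq a) : IsSumSq (f a) := by
  induction h with
  | zero => simp
  | sq_add b _ ih => rw [map_add, map_mul]; exact ih.sq_add _

theorem isSemireal_of_ringHom {A B : Type*} [CommRing A] [CommRing B] [IsSemireal B]
    (f : A →+* B) : IsSemireal A :=
  IsSemireal.of_not_isSumSq_neg_one fun h =>
    IsSemireal.not_isSumSq_neg_one B (by simpa using h.map f)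

namespace IsRealClosed

open Polynomial

/-- The polynomial `(X - u) ^ 2 + v ^ 2`, whose roots are `u + v * i` and `u - v * i`, divides every
real polynomial that has the nonreal root `u + v * i`. -/
theorem sq_add_sq_dvd {R : Type*} [Field R] [IsRealClosed R] {p : R[X]} {z : AdjoinI R}
    (hz : aeval z p = 0) (him : z.im ≠ 0) : (X - C z.re) ^ 2 + C (z.im ^ 2) ∣ p := by
  set D : R[X] := (X - C z.re) ^ 2 + C (z.im ^ 2) with hD
  have hdeg : D.natDegree = 2 := by rw [hD]; compute_degree!
  have hmonic : D.Monic := by rw [hD]; monicity!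
  have hDz : aeval z D = 0 := by
    simp only [hD, map_add, map_pow, map_sub, aeval_X, aeval_C]
    ext <;> simp [pow_two]
  rw [← modByMonic_eq_zero_iff_dvd hmonic]
  have hrz : aeval z (p %ₘ D) = 0 := by
    have := congrArg (aeval z) (modByMonic_add_div p D)
    simpa [hDz, hz] using this
  have hrdeg : (p %ₘ D).natDegree ≤ 1 := by
    have := natDegree_modByMonic_lt p hmonic (by intro h; simp [h] at hdeg)
    omega
  obtain ⟨a, b, hab⟩ := exists_eq_X_add_C_of_natDegree_le_one hrdeg
  rw [hab] at hrz ⊢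
  simp only [map_add, map_mul, aeval_X, aeval_C] at hrz
  have h1 := congrArg QuadraticAlgebra.im hrz
  have h2 := congrArg QuadraticAlgebra.re hrz
  have ha : a = 0 := by simpa [him] using h1
  have hb : b = 0 := by simpa [ha] using h2
  simp [ha, hb]

/-- A real closed field has no proper algebraic extension in which `-1` is not a sum of squares. -/
theorem mem_range_algebraMap_of_isAlgebraic {R N : Type*} [Field R] [IsRealClosed R] [Field N]
    [IsSemireal N] [Algebra R N] {y : N} (hy : IsAlgebraic R y) :
    y ∈ (algebraMap R N).range := by
  have hint := hy.isIntegral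
  obtain ⟨z, hz⟩ := IsAlgClosed.exists_aeval_eq_zero (AdjoinI R) (minpoly R y)
    (minpoly.degree_pos hint).ne'
  -- `y` and `z` are roots of the same irreducible polynomial, hence both are roots of
  -- `(X - u) ^ 2 + v ^ 2`, where `z = u + v * i`
  have hdvd : minpoly R y ∣ (X - C z.re) ^ 2 + C (z.im ^ 2) := by
    rw [minpoly.eq_of_irreducible_of_monic (minpoly.irreducible hint) hz (minpoly.monic hint)]
    refine minpoly.dvd R z ?_
    simp only [map_add, map_pow, map_sub, aeval_X, aeval_C]
    ext <;> simp [pow_two]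
  have hy0 : (y - algebraMap R N z.re) ^ 2 + algebraMap R N z.im ^ 2 = 0 := by
    simpa using aeval_eq_zero_of_dvd_aeval_eq_zero hdvd (minpoly.aeval R y)
  by_cases him : algebraMap R N z.im = 0
  · refine ⟨z.re, ?_⟩
    rw [him, zero_pow two_ne_zero, add_zero] at hy0
    exact (sub_eq_zero.1 (pow_eq_zero_iff two_ne_zero |>.1 hy0)).symm
  · refine absurd ?_ (IsSemireal.not_isSumSq_neg_one N)
    rw [show (-1 : N) = (y - algebraMap R N z.re) / algebraMap R N z.im *
      ((y - algebraMap R N z.re) / algebraMap R N z.im) by field_simp; linear_combination -hy0]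
    exact IsSumSq.mul_self _

/-- A field that is relatively algebraically closed in a real closed field is real closed. -/
theorem of_forall_isAlgebraic_mem_range {M N : Type*} [Field M] [Field N] [IsRealClosed N]
    [Algebra M N] (h : ∀ y : N, IsAlgebraic M y → y ∈ (algebraMap M N).range) :
    IsRealClosed M where
  toIsSemireal := isSemireal_of_ringHom (algebraMap M N)
  isSquare_or_isSquare_neg x := by
    have key (a : M) (ha : IsSquare (algebraMap M N a)) : IsSquare a := by
      obtain ⟨b, hb⟩ := ha
      obtain ⟨c, rfl⟩ := h b ⟨X ^ 2 - C a, (monic_X_pow_sub_C a two_ne_zero).ne_zero, by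
        simp [hb, pow_two]⟩
      exact ⟨c, (algebraMap M N).injective (by rw [hb, map_mul])⟩
    refine (isSquare_or_isSquare_neg (algebraMap M N x)).imp (key x) fun hx => key (-x) ?_
    rwa [map_neg]
  exists_isRoot_of_odd_natDegree {f} hf := by
    obtain ⟨y, hy⟩ := exists_isRoot_of_odd_natDegree (f := f.map (algebraMap M N))
      (by rwa [natDegree_map])
    have hf0 : f ≠ 0 := by rintro rfl; simp at hf
    have hy' : aeval y f = 0 := by rwa [IsRoot.def, eval_map_algebraMap] at hy
    obtain ⟨x, rfl⟩ := h y ⟨f, hf0, hy'⟩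
    refine ⟨x, ?_⟩
    rwa [aeval_algebraMap_apply, map_eq_zero] at hy'

/-- The intermediate value theorem: a polynomial without a root between `a` and `b` has the same
sign at `a` and `b`. -/
theorem eval_mul_eval_pos {R : Type*} [Field R] [IsRealClosed R] [LinearOrder R]
    [IsStrictOrderedRing R] {a b : R} (p : R[X]) (h : ∀ c ∈ Set.uIcc a b, p.eval c ≠ 0) :
    0 < p.eval a * p.eval b := by
  induction hn : p.natDegree using Nat.strong_induction_on generalizing p with
  | _ n ih =>
    rcases Nat.eq_zero_or_pos n with rfl | hpos
    · obtain ⟨c, rfl⟩ := natDegree_eq_zero.1 hn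
      have := h a Set.left_mem_uIcc
      simp only [eval_C] at this ⊢
      exact mul_self_pos.2 this
    have hp0 : p ≠ 0 := by rintro rfl; simp at hn; omega
    obtain ⟨z, hz⟩ := IsAlgClosed.exists_aeval_eq_zero (AdjoinI R) p
      (by rw [degree_eq_natDegree hp0, hn]; exact_mod_cast hpos.ne')
    by_cases him : z.im = 0
    · have hz' : z = algebraMap R _ z.re := by ext <;> simp [him]
      rw [hz', aeval_algebraMap_apply, map_eq_zero] at hz
      obtain ⟨q, rfl⟩ := dvd_iff_isRoot.2 hz
      have hq := ih q.natDegree (by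
        have := natDegree_mul (left_ne_zero_of_mul hp0) (right_ne_zero_of_mul hp0)
        rw [natDegree_X_sub_C] at this; omega) q
        (fun c hc h0 => h c hc (by simp [h0])) rfl
      have hu : z.re ∉ Set.uIcc a b := fun hu => h _ hu hz
      have hpos' : 0 < (a - z.re) * (b - z.re) := by
        rcases lt_or_ge z.re (min a b) with h1 | h1
        · exact mul_pos (sub_pos.2 (h1.trans_le (min_le_left _ _)))
            (sub_pos.2 (h1.trans_le (min_le_right _ _)))
        · have h2 : max a b < z.re := not_le.1 fun h2 => hu ⟨h1, h2⟩
          exact mul_pos_of_neg_of_neg (sub_neg.2 ((le_max_left _ _).trans_lt h2))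
            (sub_neg.2 ((le_max_right _ _).trans_lt h2))
      have := mul_pos hpos' hq
      simp only [eval_mul, eval_sub, eval_X, eval_C]
      linarith
    · obtain ⟨q, rfl⟩ := sq_add_sq_dvd hz him
      have hdeg : ((X - C z.re) ^ 2 + C (z.im ^ 2) : R[X]).natDegree = 2 := by compute_degree!
      have hq := ih q.natDegree (by
        have := natDegree_mul (left_ne_zero_of_mul hp0) (right_ne_zero_of_mul hp0)
        omega) q
        (fun c hc h0 => h c hc (by simp [h0])) rfl
      have hpos' (c : R) : 0 < (c - z.re) ^ 2 + z.im ^ 2 :=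
        add_pos_of_nonneg_of_pos (sq_nonneg _) (by positivity)
      have := mul_pos (mul_pos (hpos' a) (hpos' b)) hq
      simp only [eval_mul, eval_sub, eval_X, eval_C, eval_add, eval_pow]
      linarith

end IsRealClosed

/-! ### The signature of the trace form -/

/-- A system of fewer equations than unknowns has a nonzero solution, also if the unknowns are
restricted to `S` and the equations to `T`. -/
theorem LinearMap.exists_ne_zero_of_card_lt {R ι κ : Type*} [Field R] [Finite ι]
    (f : (ι → R) →ₗ[R] (κ → R)) {S : Finset ι} {T : Finset κ} (h : T.card < S.card) :
    ∃ x : ι → R, x ≠ 0 ∧ (∀ i ∉ S, x i = 0) ∧ ∀ t ∈ T, f x t = 0 := by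
  let g : (S → R) →ₗ[R] (T → R) :=
    LinearMap.funLeft R R (Subtype.val : T → κ) ∘ₗ f ∘ₗ
      Function.ExtendByZero.linearMap R (Subtype.val : S → ι)
  have hker : LinearMap.ker g ≠ ⊥ := LinearMap.ker_ne_bot_of_finrank_lt (by simpa using h)
  obtain ⟨y, hy, hy0⟩ := Submodule.exists_mem_ne_zero_of_ne_bot hker
  have hy' : ∀ t ∈ T, f (Function.extend Subtype.val y 0) t = 0 := fun t ht =>
    congrFun (LinearMap.mem_ker.1 hy) ⟨t, ht⟩
  refine ⟨Function.extend Subtype.val y 0, fun h0 => hy0 ?_, fun i hi => ?_, hy'⟩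
  · funext i
    rw [← Subtype.val_injective.extend_apply y 0 i, h0]
    rfl
  · rw [Function.extend_apply' _ _ _ (by rintro ⟨a, rfl⟩; exact hi a.2)]
    rfl

/-- For an involution of a finite set, there is a set `T` that contains exactly one element of every
two-element orbit. -/
theorem Function.Involutive.exists_finset_representatives {X : Type*} [Fintype X] [DecidableEq X]
    {τ : X → X} (hτ : τ.Involutive) :
    ∃ T : Finset X, (∀ σ, σ ∈ T ∨ τ σ ∈ T ∨ τ σ = σ) ∧
      2 * T.card + (Finset.univ.filter fun σ => τ σ = σ).card = Fintype.card X := by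
  let e := Fintype.equivFin X
  refine ⟨Finset.univ.filter fun σ => e (τ σ) < e σ, fun σ => ?_, ?_⟩
  · simp only [Finset.mem_filter, Finset.mem_univ, true_and, hτ σ]
    rcases lt_trichotomy (e (τ σ)) (e σ) with h | h | h
    · exact Or.inl h
    · exact Or.inr (Or.inr (e.injective h))
    · exact Or.inr (Or.inl h)
  · have himage : (Finset.univ.filter fun σ => e σ < e (τ σ)).card =
        (Finset.univ.filter fun σ => e (τ σ) < e σ).card :=
      Finset.card_bij (fun σ _ => τ σ) (by simp [hτ _]) (fun a _ b _ h => hτ.injective h)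
        fun b hb => ⟨τ b, by simpa [hτ b] using hb, hτ b⟩
    have h1 := Finset.card_filter_add_card_filter_not (s := (Finset.univ : Finset X))
      (fun σ => e (τ σ) < e σ)
    have h2 := Finset.card_filter_add_card_filter_not
      (s := Finset.univ.filter fun σ => ¬ e (τ σ) < e σ) (fun σ => e σ < e (τ σ))
    rw [Finset.filter_filter, Finset.filter_filter] at h2
    have h3 : (Finset.univ.filter fun σ => ¬ e (τ σ) < e σ ∧ e σ < e (τ σ)) =
        Finset.univ.filter fun σ => e σ < e (τ σ) :=
      Finset.filter_congr fun σ _ => ⟨fun h => h.2, fun h => ⟨h.asymm, h⟩⟩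
    have h4 : (Finset.univ.filter fun σ => ¬ e (τ σ) < e σ ∧ ¬ e σ < e (τ σ)) =
        Finset.univ.filter fun σ => τ σ = σ :=
      Finset.filter_congr fun σ _ => by
        rw [not_lt, not_lt, ← le_antisymm_iff, eq_comm, e.injective.eq_iff]
    rw [h3, h4, himage] at h2
    rw [Finset.card_univ] at h1
    omega

namespace AdjoinI

/-- Complex conjugation on `R[i]`. -/
def conj (K : Type*) {R : Type*} [CommRing K] [CommRing R] [Algebra K R] :
    AdjoinI R →ₐ[K] AdjoinI R where
  toRingHom := starRingEnd (AdjoinI R)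
  commutes' r := by
    change star (algebraMap K (AdjoinI R) r) = _
    rw [IsScalarTower.algebraMap_apply K R (AdjoinI R)]
    ext <;> simp

variable {K R : Type*} [CommRing K] [CommRing R] [Algebra K R]

@[simp] theorem re_conj (z : AdjoinI R) : (conj K z).re = z.re := by
  change (star z).re = _
  simp

@[simp] theorem im_conj (z : AdjoinI R) : (conj K z).im = -z.im := by
  change (star z).im = _
  simp

theorem conj_involutive {L : Type*} [CommRing L] [Algebra K L] :
    Function.Involutive fun σ : L →ₐ[K] AdjoinI R => (conj K).comp σ := by
  intro σ
  ext z <;> simp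

/-- An embedding into `R[i]` that is fixed by conjugation takes its values in `R`. -/
theorem nonempty_algHom_of_conj_comp_eq {R : Type*} [Field R] [CharZero R] [Algebra K R]
    {L : Type*} [CommRing L] [Algebra K L]
    {σ : L →ₐ[K] AdjoinI R} (h : (conj K).comp σ = σ) : Nonempty (L →ₐ[K] R) := by
  have him (z : L) : (σ z).im = 0 := by
    have := congrArg QuadraticAlgebra.im (DFunLike.congr_fun h z)
    simp only [AlgHom.comp_apply, im_conj] at this
    exact self_eq_neg.1 this.symm
  exact ⟨{
    toFun := fun z => (σ z).re
    map_one' := by simp [QuadraticAlgebra.re_one]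
    map_mul' := fun x y => by simp [him]
    map_zero' := by simp
    map_add' := fun x y => by simp
    commutes' := fun r => by
      rw [AlgHom.commutes, IsScalarTower.algebraMap_apply K R (AdjoinI R),
        QuadraticAlgebra.algebraMap_re] }⟩

end AdjoinI

section TraceForm

variable {K L R ι : Type*} [Field K] [Field L] [Field R] [IsRealClosed R] [Algebra K L]
  [Algebra K R] [FiniteDimensional K L] [Fintype ι]

/-- For a basis `e` orthogonal for the trace form, the diagonal form with the coefficients
`tr (e i ^ 2)` is over `R` the sum of the squares of the linear forms that the embeddings of `L`
into `R[i]` define. -/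
theorem sum_algHom_sq_eq (e : ι → L)
    (he : ∀ i j, i ≠ j → Algebra.trace K L (e i * e j) = 0) (x : ι → R) :
    ∑ σ : L →ₐ[K] AdjoinI R, (∑ i, x i • σ (e i)) ^ 2 =
      algebraMap R (AdjoinI R)
        (∑ i, algebraMap K R (Algebra.trace K L (e i * e i)) * x i ^ 2) := by
  classical
  have : CharZero K := (algebraMap K R).charZero
  have h1 (σ : L →ₐ[K] AdjoinI R) : (∑ i, x i • σ (e i)) ^ 2 =
      ∑ i, ∑ j, (x i * x j) • σ (e i * e j) := by
    rw [pow_two, Finset.sum_mul_sum]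
    refine Finset.sum_congr rfl fun i _ => Finset.sum_congr rfl fun j _ => ?_
    rw [smul_mul_smul_comm, map_mul]
  simp_rw [h1]
  rw [Finset.sum_comm, map_sum]
  refine Finset.sum_congr rfl fun i _ => ?_
  rw [Finset.sum_comm]
  have h2 (j : ι) : ∑ σ : L →ₐ[K] AdjoinI R, (x i * x j) • σ (e i * e j) =
      (x i * x j) • algebraMap K (AdjoinI R) (Algebra.trace K L (e i * e j)) := by
    rw [← Finset.smul_sum, trace_eq_sum_embeddings]
  simp_rw [h2]
  rw [Finset.sum_eq_single i (fun j _ hj => by rw [he i j hj.symm, map_zero, smul_zero])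
    (by simp), IsScalarTower.algebraMap_apply K R (AdjoinI R), Algebra.smul_def, ← map_mul]
  congr 1
  ring

/-- The linear forms on `R ^ ι` that the embeddings of `L` into `R[i]` define, followed by a linear
form `l` on `R[i]`. -/
noncomputable def embeddingForms (K : Type*) [Field K] [Algebra K L] [Algebra K R] (e : ι → L)
    (l : AdjoinI R →ₗ[R] R) :
    (ι → R) →ₗ[R] ((L →ₐ[K] AdjoinI R) → R) :=
  LinearMap.pi fun σ => l ∘ₗ Fintype.linearCombination R fun i => σ (e i)

omit [FiniteDimensional K L] in
theorem embeddingForms_apply (e : ι → L) (l : AdjoinI R →ₗ[R] R) (x : ι → R)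
    (σ : L →ₐ[K] AdjoinI R) : embeddingForms K e l x σ = l (∑ i, x i • σ (e i)) := by
  simp [embeddingForms, Fintype.linearCombination_apply]

omit [FiniteDimensional K L] in
theorem conj_sum_smul (e : ι → L) (x : ι → R) (σ : L →ₐ[K] AdjoinI R) :
    ∑ i, x i • ((AdjoinI.conj K).comp σ) (e i) = AdjoinI.conj R (∑ i, x i • σ (e i)) := by
  rw [map_sum]
  refine Finset.sum_congr rfl fun i _ => ?_
  ext <;> simp

variable [LinearOrder R] [IsStrictOrderedRing R]

/-- If `L` embeds into `R`, the trace form has less than `[L : K] / 2` negative diagonal entries: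
on a larger negative subspace some nonzero vector would make all the linear forms real. -/
theorem two_mul_card_neg_lt (e : ι → L)
    (he : ∀ i j, i ≠ j → Algebra.trace K L (e i * e j) = 0) (f : L →ₐ[K] R) :
    2 * (Finset.univ.filter fun i =>
      algebraMap K R (Algebra.trace K L (e i * e i)) < 0).card < Module.finrank K L := by
  classical
  have : CharZero K := (algebraMap K R).charZero
  obtain ⟨T, hT, hcard⟩ :=
    (AdjoinI.conj_involutive (K := K) (R := R) (L := L)).exists_finset_representatives
  rw [AlgHom.card K L (AdjoinI R)] at hcard
  let σ₀ : L →ₐ[K] AdjoinI R := (IsScalarTower.toAlgHom K R (AdjoinI R)).comp f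
  have hfix : 0 < (Finset.univ.filter fun σ : L →ₐ[K] AdjoinI R =>
      (AdjoinI.conj K).comp σ = σ).card := by
    refine Finset.card_pos.2 ⟨σ₀, ?_⟩
    simp only [Finset.mem_filter, Finset.mem_univ, true_and]
    ext z <;> simp [σ₀]
  by_contra! hlt
  obtain ⟨x, hx0, hxS, hxT⟩ := (embeddingForms K e (QuadraticAlgebra.imₗ (R := R) (-1) 0)
    ).exists_ne_zero_of_card_lt (T := T) (S := Finset.univ.filter fun i =>
      algebraMap K R (Algebra.trace K L (e i * e i)) < 0) (by omega)
  simp only [embeddingForms_apply, QuadraticAlgebra.imₗ, LinearMap.coe_mk, AddHom.coe_mk] at hxT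
  have him (σ : L →ₐ[K] AdjoinI R) : (∑ i, x i • σ (e i)).im = 0 := by
    rcases hT σ with h | h | h
    · exact hxT σ h
    · have := hxT _ h
      rwa [conj_sum_smul, AdjoinI.im_conj, neg_eq_zero] at this
    · have := conj_sum_smul e x σ
      rw [h] at this
      have := congrArg QuadraticAlgebra.im this
      rw [AdjoinI.im_conj] at this
      exact self_eq_neg.1 this
  have hsum := congrArg (QuadraticAlgebra.reₗ (R := R) (-1) 0) (sum_algHom_sq_eq e he x)
  rw [map_sum] at hsum
  simp only [QuadraticAlgebra.reₗ, LinearMap.coe_mk, AddHom.coe_mk,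
    QuadraticAlgebra.algebraMap_re] at hsum
  have hpos : 0 ≤ ∑ σ : L →ₐ[K] AdjoinI R, ((∑ i, x i • σ (e i)) ^ 2).re :=
    Finset.sum_nonneg fun σ _ => by
      rw [pow_two, QuadraticAlgebra.re_mul, him σ]
      simpa using mul_self_nonneg _
  obtain ⟨i, hi⟩ := Function.ne_iff.1 hx0
  have hneg : ∑ i, algebraMap K R (Algebra.trace K L (e i * e i)) * x i ^ 2 < 0 := by
    have hS (j : ι) (hj : x j ≠ 0) : algebraMap K R (Algebra.trace K L (e j * e j)) < 0 := by
      by_contra h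
      exact hj (hxS j (by simpa using h))
    refine Finset.sum_neg' (fun j _ => ?_) ⟨i, Finset.mem_univ i,
      mul_neg_of_neg_of_pos (hS i hi) (by have : x i ≠ 0 := hi; positivity)⟩
    by_cases hj : x j = 0
    · simp [hj]
    · exact mul_nonpos_of_nonpos_of_nonneg (hS j hj).le (sq_nonneg _)
  rw [hsum] at hpos
  exact absurd hneg hpos.not_gt

/-- If `L` does not embed into `R`, the trace form has at most `[L : K] / 2` positive diagonal
entries: on a larger positive subspace some nonzero vector would make all the linear forms purely
imaginary. -/
theorem two_mul_card_pos_le (e : ι → L)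
    (he : ∀ i j, i ≠ j → Algebra.trace K L (e i * e j) = 0) (hf : IsEmpty (L →ₐ[K] R)) :
    2 * (Finset.univ.filter fun i =>
      0 < algebraMap K R (Algebra.trace K L (e i * e i))).card ≤ Module.finrank K L := by
  classical
  have : CharZero K := (algebraMap K R).charZero
  obtain ⟨T, hT, hcard⟩ :=
    (AdjoinI.conj_involutive (K := K) (R := R) (L := L)).exists_finset_representatives
  rw [AlgHom.card K L (AdjoinI R)] at hcard
  by_contra! hlt
  obtain ⟨x, hx0, hxS, hxT⟩ := (embeddingForms K e (QuadraticAlgebra.reₗ (R := R) (-1) 0)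
    ).exists_ne_zero_of_card_lt (T := T) (S := Finset.univ.filter fun i =>
      0 < algebraMap K R (Algebra.trace K L (e i * e i))) (by omega)
  simp only [embeddingForms_apply, QuadraticAlgebra.reₗ, LinearMap.coe_mk, AddHom.coe_mk] at hxT
  have hre (σ : L →ₐ[K] AdjoinI R) : (∑ i, x i • σ (e i)).re = 0 := by
    rcases hT σ with h | h | h
    · exact hxT σ h
    · have := hxT _ h
      rwa [conj_sum_smul, AdjoinI.re_conj] at this
    · exact (hf.false (AdjoinI.nonempty_algHom_of_conj_comp_eq h).some).elim
  have hsum := congrArg (QuadraticAlgebra.reₗ (R := R) (-1) 0) (sum_algHom_sq_eq e he x)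
  rw [map_sum] at hsum
  simp only [QuadraticAlgebra.reₗ, LinearMap.coe_mk, AddHom.coe_mk,
    QuadraticAlgebra.algebraMap_re] at hsum
  have hneg : ∑ σ : L →ₐ[K] AdjoinI R, ((∑ i, x i • σ (e i)) ^ 2).re ≤ 0 :=
    Finset.sum_nonpos fun σ _ => by
      rw [pow_two, QuadraticAlgebra.re_mul, hre σ]
      simpa using mul_self_nonneg _
  obtain ⟨i, hi⟩ := Function.ne_iff.1 hx0
  have hpos : 0 < ∑ i, algebraMap K R (Algebra.trace K L (e i * e i)) * x i ^ 2 := by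
    have hS (j : ι) (hj : x j ≠ 0) : 0 < algebraMap K R (Algebra.trace K L (e j * e j)) := by
      by_contra h
      exact hj (hxS j (by simpa using h))
    refine Finset.sum_pos' (fun j _ => ?_) ⟨i, Finset.mem_univ i,
      mul_pos (hS i hi) (by have : x i ≠ 0 := hi; positivity)⟩
    by_cases hj : x j = 0
    · simp [hj]
    · exact mul_nonneg (hS j hj).le (sq_nonneg _)
  rw [hsum] at hneg
  exact absurd hpos hneg.not_gt

end TraceForm

/-- Let `R` and `R'` be real closed extensions of `K` that induce the same ordering of `K`. A finite
extension of `K` that embeds into `R` also embeds into `R'`. -/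
theorem nonempty_algHom_of_algHom {K L R R' : Type*} [Field K] [Field L] [Algebra K L]
    [FiniteDimensional K L] [Field R] [IsRealClosed R] [LinearOrder R] [IsStrictOrderedRing R]
    [Algebra K R] [Field R'] [IsRealClosed R'] [LinearOrder R'] [IsStrictOrderedRing R']
    [Algebra K R'] (h : ∀ z : K, 0 < algebraMap K R z → 0 < algebraMap K R' z) (f : L →ₐ[K] R) :
    Nonempty (L →ₐ[K] R') := by
  classical
  have : CharZero K := (algebraMap K R).charZero
  have : Invertible (2 : K) := invertibleOfNonzero two_ne_zero
  obtain ⟨e, he⟩ := LinearMap.BilinForm.exists_orthogonal_basis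
    (LinearMap.BilinForm.isSymm_iff.1 (Algebra.traceForm_isSymm K (S := L)))
  have he' : ∀ i j, i ≠ j → Algebra.trace K L (e i * e j) = 0 := fun i j hij =>
    LinearMap.isOrthoᵢ_def.1 he i j hij
  have hne (i) : Algebra.trace K L (e i * e i) ≠ 0 :=
    LinearMap.BilinForm.iIsOrtho.not_isOrtho_basis_self_of_nondegenerate he
      (traceForm_nondegenerate K L) i
  by_contra hcon
  have h1 := two_mul_card_neg_lt e he' f
  have h2 := two_mul_card_pos_le (R := R') e he' (not_nonempty_iff.1 hcon)
  have h3 : (Finset.univ : Finset (Fin (Module.finrank K L))) =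
      (Finset.univ.filter fun i => algebraMap K R (Algebra.trace K L (e i * e i)) < 0) ∪
        Finset.univ.filter fun i => 0 < algebraMap K R' (Algebra.trace K L (e i * e i)) := by
    ext i
    simp only [Finset.mem_univ, Finset.mem_union, Finset.mem_filter, true_and, true_iff]
    refine (lt_or_gt_of_ne ?_).imp_right (h _)
    rw [map_ne_zero]
    exact hne i
  have h4 := congrArg Finset.card h3
  rw [Finset.card_univ, Fintype.card_fin] at h4
  have h5 := h4.trans_le (Finset.card_union_le _ _)
  omega

/-! ### Ultrapowers of real closed fields -/

open Filter in
/-- An ultrapower of a real closed field is real closed. -/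
theorem Filter.Germ.isRealClosed {α R : Type*} (φ : Ultrafilter α) [Field R] [IsRealClosed R]
    [LinearOrder R] [IsStrictOrderedRing R] : IsRealClosed (Germ (φ : Filter α) R) := by
  refine IsRealClosed.of_linearOrderedField (fun {x} hx => ?_) fun {f} hf => ?_
  · induction x using Germ.inductionOn with | _ g
    choose s hs using fun a : R => show ∃ s, 0 ≤ a → a = s * s from by
      by_cases ha : 0 ≤ a
      · obtain ⟨s, hs⟩ := IsSquare.of_nonneg ha
        exact ⟨s, fun _ => hs⟩
      · exact ⟨0, fun h => absurd h ha⟩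
    refine ⟨((fun a => s (g a) : α → R) : Germ (φ : Filter α) R), ?_⟩
    rw [← Germ.coe_mul, Germ.coe_eq]
    exact (Germ.coe_nonneg.1 hx).mono fun a ha => hs _ ha
  · -- a root is chosen pointwise, for representatives `c i` of the coefficients
    choose c hc using fun i => (Quotient.exists_rep (f.coeff i) :
      ∃ g : α → R, (g : Germ (φ : Filter α) R) = f.coeff i)
    let F (a : α) : Polynomial R := ∑ i ∈ Finset.range (f.natDegree + 1),
      Polynomial.monomial i (c i a)
    have hcoeff (a : α) (i : ℕ) (hi : i ≤ f.natDegree) : (F a).coeff i = c i a := by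
      simp [F, Polynomial.finsetSum_coeff, Polynomial.coeff_monomial, hi]
    have hdeg (a : α) (ha : c f.natDegree a ≠ 0) : (F a).natDegree = f.natDegree := by
      refine Polynomial.natDegree_eq_of_le_of_coeff_ne_zero ?_ (by rwa [hcoeff a _ le_rfl])
      refine Polynomial.natDegree_sum_le_of_forall_le _ _ fun i hi => ?_
      exact (Polynomial.natDegree_monomial_le _).trans (Nat.lt_succ_iff.1 (Finset.mem_range.1 hi))
    choose r hr using fun a => show ∃ r : R, c f.natDegree a ≠ 0 → (F a).eval r = 0 from by
      by_cases ha : c f.natDegree a = 0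
      · exact ⟨0, fun h => absurd ha h⟩
      · obtain ⟨r, hr⟩ := IsRealClosed.exists_isRoot_of_odd_natDegree (f := F a)
          (by rwa [hdeg a ha])
        exact ⟨r, fun _ => hr⟩
    have hne : ∀ᶠ a in (φ : Filter α), c f.natDegree a ≠ 0 := by
      refine Ultrafilter.eventually_not.2 fun h => ?_
      have h0 : f.leadingCoeff = 0 := by
        rw [Polynomial.leadingCoeff, ← hc]
        exact Germ.coe_eq.2 h
      rw [Polynomial.leadingCoeff_eq_zero.1 h0] at hf
      simp at hf
    refine ⟨((r : α → R) : Germ (φ : Filter α) R), ?_⟩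
    rw [Polynomial.IsRoot.def, Polynomial.eval_eq_sum_range]
    have hsum : ∑ i ∈ Finset.range (f.natDegree + 1), f.coeff i *
        ((r : α → R) : Germ (φ : Filter α) R) ^ i =
        ((∑ i ∈ Finset.range (f.natDegree + 1), c i * r ^ i : α → R) :
          Germ (φ : Filter α) R) := by
      rw [← Germ.coe_coeRingHom, map_sum]
      refine Finset.sum_congr rfl fun i _ => ?_
      rw [← hc i]
      rfl
    rw [hsum, ← Germ.coe_zero, Germ.coe_eq]
    refine hne.mono fun a ha => ?_
    have := hr a ha
    simp only [F, Polynomial.eval_finsetSum, Polynomial.eval_monomial] at this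
    simpa using this

/-! ### Existentially closed homomorphisms -/

section ExistentiallyClosed

variable {A B C : Type*} [CommRing A] [CommRing B] [CommRing C]

theorem mem_zerosThrough_span_iff {f : A →+* B} {n : ℕ} {s : Set (MvPolynomial (Fin n) A)}
    {b : Fin n → B} : b ∈ zerosThrough f (Ideal.span s) ↔ ∀ p ∈ s, MvPolynomial.eval₂ f b p = 0 := by
  refine ⟨fun h p hp => h p (Ideal.subset_span hp), fun h p hp => ?_⟩
  have : Ideal.span s ≤ RingHom.ker (MvPolynomial.eval₂Hom f b) := Ideal.span_le.2 h
  exact this hp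

theorem IsExistentiallyClosedHom.comp {g : B →+* C} {f : A →+* B}
    (hg : IsExistentiallyClosedHom g) (hf : IsExistentiallyClosedHom f) :
    IsExistentiallyClosedHom (g.comp f) := by
  rintro n I hI ⟨c, hc⟩
  refine hf n I hI ?_
  obtain ⟨s, rfl⟩ := hI
  obtain ⟨b, hb⟩ := hg n (Ideal.span (MvPolynomial.map f '' s))
    (Submodule.fg_span (s.finite_toSet.image _)) ⟨c, by
      rw [mem_zerosThrough_span_iff]
      rintro _ ⟨p, hp, rfl⟩
      rw [MvPolynomial.eval₂_map]
      exact hc p (Ideal.subset_span hp)⟩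
  refine ⟨b, mem_zerosThrough_span_iff.2 fun p hp => ?_⟩
  have := hb _ (Ideal.subset_span ⟨p, hp, rfl⟩)
  rwa [MvPolynomial.eval₂_map, RingHom.id_comp] at this

theorem IsExistentiallyClosedHom.of_comp {g : B →+* C} {f : A →+* B}
    (h : IsExistentiallyClosedHom (g.comp f)) : IsExistentiallyClosedHom f := by
  rintro n I hI ⟨b, hb⟩
  refine h n I hI ⟨g ∘ b, fun p hp => ?_⟩
  have := congrArg g (hb p hp)
  rwa [MvPolynomial.hom_eval₂, map_zero] at this

theorem isExistentiallyClosedHom_id : IsExistentiallyClosedHom (RingHom.id A) :=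
  fun _ _ _ h => h

end ExistentiallyClosed

open Filter in
/-- The diagonal embedding of a ring into an ultrapower is existentially closed. -/
theorem isExistentiallyClosedHom_germ {α A : Type*} [CommRing A] (φ : Ultrafilter α) :
    IsExistentiallyClosedHom
      ((Germ.coeRingHom (φ : Filter α)).comp (Pi.constRingHom α A)) := by
  rintro n I ⟨s, rfl⟩ ⟨b, hb⟩
  choose β hβ using fun i => (Quotient.exists_rep (b i) :
    ∃ g : α → A, Germ.coeRingHom (φ : Filter α) g = b i)
  have hs : ∀ p ∈ s, ∀ᶠ a in (φ : Filter α),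
      MvPolynomial.eval₂ (RingHom.id A) (fun i => β i a) p = 0 := fun p hp => by
    have h1 := hb p (Ideal.subset_span hp)
    obtain rfl : (Germ.coeRingHom (φ : Filter α)) ∘ β = b := funext hβ
    rw [Function.comp_def, ← MvPolynomial.hom_eval₂,
      ← map_zero (Germ.coeRingHom (φ : Filter α))] at h1
    refine (Germ.coe_eq.1 h1).mono fun a ha => ?_
    have h2 : Pi.evalRingHom (fun _ => A) a
        (MvPolynomial.eval₂ (Pi.constRingHom α A) β p) = 0 := ha
    rw [MvPolynomial.hom_eval₂] at h2
    exact h2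
  obtain ⟨a, ha⟩ := ((Filter.eventually_all_finset s).2 hs).exists
  exact ⟨fun i => β i a, mem_zerosThrough_span_iff.2 ha⟩

/-! ### Homomorphisms between real closed fields -/

namespace IsRealClosed

open Polynomial Filter

theorem strictMono_ringHom {R S : Type*} [Field R] [IsRealClosed R] [LinearOrder R]
    [IsStrictOrderedRing R] [Field S] [LinearOrder S] [IsStrictOrderedRing S] (f : R →+* S) :
    StrictMono f := by
  refine Monotone.strictMono_of_injective (fun a b hab => ?_) f.injective
  rw [← sub_nonneg, ← map_sub]
  exact ((IsSquare.of_nonneg (sub_nonneg.2 hab)).map f).nonneg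

/-- Let `x` be an element of a real closed field `N` outside the real closed subfield `M`. A
polynomial over `M` that is positive at `x` is positive at every element of `M` that lies on the
same side as `x` of all its roots in `M`. -/
theorem eval_pos_of_aeval_pos {M N : Type*} [Field M] [IsRealClosed M] [LinearOrder M]
    [IsStrictOrderedRing M] [Field N] [IsRealClosed N] [LinearOrder N] [IsStrictOrderedRing N]
    [Algebra M N] {x : N} (hx : x ∉ (algebraMap M N).range) {q : M[X]} (hq : 0 < aeval x q) {a : M}
    (hlt : ∀ z ∈ q.roots, algebraMap M N z < x → z < a)
    (hgt : ∀ z ∈ q.roots, x < algebraMap M N z → a < z) : 0 < q.eval a := by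
  have hmono := strictMono_ringHom (algebraMap M N)
  have hq0 : q ≠ 0 := by rintro rfl; simp at hq
  have h := eval_mul_eval_pos (a := algebraMap M N a) (b := x) (q.map (algebraMap M N))
    fun c hc h0 => by
    rw [eval_map_algebraMap] at h0
    -- the roots of `q` in `N` lie in `M`
    obtain ⟨z, rfl⟩ := mem_range_algebraMap_of_isAlgebraic (R := M) ⟨q, hq0, h0⟩
    rw [aeval_algebraMap_apply, map_eq_zero] at h0
    have hz : z ∈ q.roots := (mem_roots hq0).2 h0
    rcases lt_trichotomy (algebraMap M N z) x with h1 | h1 | h1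
    · exact absurd hc.1 (lt_min (hmono (hlt z hz h1)) h1).not_ge
    · exact hx ⟨z, h1⟩
    · exact absurd hc.2 (max_lt (hmono (hgt z hz h1)) h1).not_ge
  rw [eval_map_algebraMap, eval_map_algebraMap, aeval_algebraMap_apply] at h
  have := pos_of_mul_pos_left h hq.le
  rwa [← map_zero (algebraMap M N), hmono.lt_iff_lt] at this

/-- For a transcendental element `x` of a real closed extension `N` of the real closed field `M`,
the ordered field `M(x)` embeds over `M` into an ultrapower of `M`. The image of `x` is a family of
elements `a Z` of `M`, indexed by the finite subsets `Z` of `M`, for which `a Z` lies on the same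
side as `x` of the elements of `Z`. -/
theorem exists_ringHom_germ {M N : Type*} [Field M] [IsRealClosed M] [LinearOrder M]
    [IsStrictOrderedRing M] [Field N] [IsRealClosed N] [LinearOrder N] [IsStrictOrderedRing N]
    [Algebra M N] [Algebra (RatFunc M) N] [IsScalarTower M (RatFunc M) N] :
    ∃ (φ : Ultrafilter (Finset M)) (Ψ : RatFunc M →+* Germ (φ : Filter (Finset M)) M),
      Ψ.comp (algebraMap M (RatFunc M)) =
        (Germ.coeRingHom (φ : Filter (Finset M))).comp (Pi.constRingHom _ M) ∧
      ∀ z, 0 < algebraMap (RatFunc M) N z → 0 < Ψ z := by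
  have hmono := strictMono_ringHom (algebraMap M N)
  set x : N := algebraMap (RatFunc M) N RatFunc.X with hxdef
  have haeval (q : M[X]) : algebraMap (RatFunc M) N (algebraMap M[X] (RatFunc M) q) = aeval x q := by
    rw [hxdef, aeval_algebraMap_apply]
    congr 1
    rw [← RatFunc.algebraMap_X, aeval_algebraMap_apply, aeval_X_left_apply]
  have haeval0 (q : M[X]) (hq : q ≠ 0) : aeval x q ≠ 0 := by
    rw [← haeval, _root_.map_ne_zero]
    exact RatFunc.algebraMap_ne_zero hq
  have hx : x ∉ (algebraMap M N).range := by
    rintro ⟨c, hc⟩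
    exact haeval0 (X - C c) (X_sub_C_ne_zero c) (by simp [hc])
  choose a halt hagt using fun Z : Finset M => show ∃ a : M,
      (∀ z ∈ Z, algebraMap M N z < x → z < a) ∧ (∀ z ∈ Z, x < algebraMap M N z → a < z) from by
    classical
    obtain ⟨a, h1, h2⟩ := Order.exists_between_finsets
      (Z.filter fun z => algebraMap M N z < x) (Z.filter fun z => x < algebraMap M N z)
      (fun y hy z hz => hmono.lt_iff_lt.1
        ((Finset.mem_filter.1 hy).2.trans (Finset.mem_filter.1 hz).2))
    exact ⟨a, fun z hz h => h1 z (Finset.mem_filter.2 ⟨hz, h⟩),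
      fun z hz h => h2 z (Finset.mem_filter.2 ⟨hz, h⟩)⟩
  let φ : Ultrafilter (Finset M) := Ultrafilter.of atTop
  let G := Germ (φ : Filter (Finset M)) M
  let κ : (Finset M → M) →+* G := Germ.coeRingHom (φ : Filter (Finset M))
  let ψ : M[X] →+* G := eval₂RingHom (κ.comp (Pi.constRingHom _ M)) (κ a)
  have hψ (q : M[X]) : ψ q = κ fun Z => q.eval (a Z) := by
    change eval₂ _ _ q = _
    rw [← hom_eval₂]
    congr 1
    funext Z
    change Pi.evalRingHom (fun _ => M) Z _ = _
    rw [hom_eval₂]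
    rfl
  have hpos (q : M[X]) (hq : 0 < aeval x q) : 0 < ψ q := by
    classical
    rw [hψ]
    refine Germ.coe_pos.2 (Ultrafilter.of_le _ ?_)
    filter_upwards [eventually_ge_atTop q.roots.toFinset] with Z hZ
    exact eval_pos_of_aeval_pos hx hq
      (fun z hz => halt Z z (hZ (Multiset.mem_toFinset.2 hz)))
      (fun z hz => hagt Z z (hZ (Multiset.mem_toFinset.2 hz)))
  have hψ0 (q : M[X]) (hq : q ≠ 0) : ψ q ≠ 0 := by
    rcases lt_or_gt_of_ne (haeval0 q hq) with h | h
    · have := hpos (-q) (by rw [map_neg]; exact neg_pos.2 h)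
      rw [map_neg] at this
      exact (neg_pos.1 this).ne
    · exact (hpos q h).ne'
  have hinj : Function.Injective ψ := (injective_iff_map_eq_zero ψ).2 fun q hq => by
    by_contra h
    exact hψ0 q h hq
  let Ψ : RatFunc M →+* G := IsFractionRing.lift hinj
  have hΨ (q : M[X]) : Ψ (algebraMap M[X] (RatFunc M) q) = ψ q :=
    IsFractionRing.lift_algebraMap hinj q
  refine ⟨φ, Ψ, ?_, fun z hz => ?_⟩
  · ext c
    rw [RingHom.comp_apply, IsScalarTower.algebraMap_apply M M[X] (RatFunc M), hΨ]
    exact eval₂_C _ _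
  · obtain ⟨p, q, hq, rfl⟩ := IsFractionRing.div_surjective (A := M[X]) z
    have hq0 : q ≠ 0 := nonZeroDivisors.ne_zero hq
    rw [map_div₀, haeval, haeval] at hz
    rw [map_div₀, hΨ, hΨ]
    -- the sign of a fraction `p / q` is that of the polynomial `p * q`
    have h1 : 0 < ψ (p * q) := hpos _ (by
      rw [map_mul]
      have := mul_pos hz (mul_self_pos.2 (haeval0 q hq0))
      rwa [← mul_assoc, div_mul_cancel₀ _ (haeval0 q hq0)] at this)
    rw [map_mul] at h1
    have h2 := div_pos h1 (mul_self_pos.2 (hψ0 q hq0))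
    rwa [mul_div_mul_right _ _ (hψ0 q hq0)] at h2

theorem isExistentiallyClosedHom_of_isAlgebraic_ratFunc {M N : Type*} [Field M] [IsRealClosed M]
    [Field N] [IsRealClosed N] [Algebra M N] [Algebra (RatFunc M) N] [IsScalarTower M (RatFunc M) N]
    [Algebra.IsAlgebraic (RatFunc M) N] : IsExistentiallyClosedHom (algebraMap M N) := by
  obtain ⟨_, _⟩ := exists_linearOrder M
  obtain ⟨_, _⟩ := exists_linearOrder N
  obtain ⟨φ, Ψ, hΨ, hpos⟩ := exists_ringHom_germ (M := M) (N := N)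
  have := Germ.isRealClosed (R := M) φ
  let : Algebra (RatFunc M) (Germ (φ : Filter (Finset M)) M) := Ψ.toAlgebra
  rintro n I hI ⟨b, hb⟩
  -- the zero lies in a finite extension `L` of `M(x)`, which embeds into the ultrapower
  let L := IntermediateField.adjoin (RatFunc M) (Set.range b)
  have : FiniteDimensional (RatFunc M) L :=
    IntermediateField.finiteDimensional_adjoin fun y _ => Algebra.IsIntegral.isIntegral y
  obtain ⟨g⟩ := nonempty_algHom_of_algHom hpos L.val
  let b' (i : Fin n) : L := ⟨b i, IntermediateField.subset_adjoin _ _ ⟨i, rfl⟩⟩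
  refine isExistentiallyClosedHom_germ φ n I hI ⟨g ∘ b', fun p hp => ?_⟩
  have h1 : MvPolynomial.eval₂ (algebraMap M L) b' p = 0 := by
    refine (algebraMap L N).injective ?_
    rw [MvPolynomial.hom_eval₂, map_zero]
    exact hb p hp
  have h2 : g.toRingHom.comp (algebraMap M L) =
      (Germ.coeRingHom (φ : Filter (Finset M))).comp (Pi.constRingHom _ M) := by
    rw [← hΨ, IsScalarTower.algebraMap_eq M (RatFunc M) L]
    ext c
    exact g.commutes _
  have h3 := congrArg g.toRingHom h1
  rw [MvPolynomial.hom_eval₂, h2, map_zero] at h3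
  exact h3

/-- Every homomorphism between real closed fields is existentially closed: the coordinates of a zero
lie in a tower of real closed fields, each of which is algebraic over the rational function field
in one variable over the preceding one. -/
theorem isExistentiallyClosedHom {k R : Type u} [Field k] [IsRealClosed k] [Field R]
    [IsRealClosed R] (f : k →+* R) : IsExistentiallyClosedHom f := by
  classical
  have key (s : Finset R) : ∃ (M : Type u) (_ : Field M) (_ : IsRealClosed M) (g : k →+* M)
      (h : M →+* R), h.comp g = f ∧ IsExistentiallyClosedHom g ∧ ∀ y ∈ s, y ∈ h.range := by
    induction s using Finset.induction_on with
    | empty => exact ⟨k, _, ‹_›, RingHom.id k, f, f.comp_id, isExistentiallyClosedHom_id, by simp⟩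
    | insert x s _ ih =>
      obtain ⟨M, _, _, g, h, hgh, hg, hs⟩ := ih
      by_cases hx : x ∈ h.range
      · exact ⟨M, _, ‹_›, g, h, hgh, hg, fun y hy =>
          (Finset.mem_insert.1 hy).elim (fun h => h ▸ hx) (hs y)⟩
      let : Algebra M R := h.toAlgebra
      have htr : Transcendental M x := fun hx' => hx (mem_range_algebraMap_of_isAlgebraic hx')
      have hinj : Function.Injective (aeval x : M[X] →ₐ[M] R).toRingHom :=
        transcendental_iff_injective.1 htr
      let : Algebra (RatFunc M) R := (IsFractionRing.lift hinj).toAlgebra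
      have hlift (q : M[X]) :
          algebraMap (RatFunc M) R (algebraMap M[X] (RatFunc M) q) = aeval x q :=
        IsFractionRing.lift_algebraMap hinj q
      have : IsScalarTower M (RatFunc M) R := IsScalarTower.of_algebraMap_eq fun c => by
        rw [IsScalarTower.algebraMap_apply M M[X] (RatFunc M), hlift]
        simp
      let N := algebraicClosure (RatFunc M) R
      have hN : IsRealClosed N := of_forall_isAlgebraic_mem_range (N := R) fun y hy =>
        ⟨⟨y, mem_algebraicClosure_iff.2 (hy.restrictScalars (RatFunc M))⟩, rfl⟩
      have : IsScalarTower M N R := IsScalarTower.of_algebraMap_eq fun c => by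
        rw [IsScalarTower.algebraMap_apply M (RatFunc M) N, ← IsScalarTower.algebraMap_apply,
          ← IsScalarTower.algebraMap_apply]
      refine ⟨N, _, hN, (algebraMap M N).comp g, algebraMap N R, ?_, ?_, ?_⟩
      · rw [← hgh, ← RingHom.comp_assoc, ← IsScalarTower.algebraMap_eq]
        rfl
      · exact isExistentiallyClosedHom_of_isAlgebraic_ratFunc.comp hg
      · intro y hy
        rcases Finset.mem_insert.1 hy with rfl | hy
        · refine ⟨algebraMap (RatFunc M) N RatFunc.X, ?_⟩
          rw [← IsScalarTower.algebraMap_apply, ← RatFunc.algebraMap_X, hlift, aeval_X]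
        · obtain ⟨z, rfl⟩ := hs y hy
          exact ⟨algebraMap M N z, (IsScalarTower.algebraMap_apply M N R z).symm⟩
  rintro n I hI ⟨b, hb⟩
  obtain ⟨M, _, _, g, h, rfl, hg, hs⟩ := key (Finset.univ.image b)
  choose c hc using fun i => hs (b i) (Finset.mem_image_of_mem b (Finset.mem_univ i))
  refine hg n I hI ⟨c, fun p hp => h.injective ?_⟩
  rw [MvPolynomial.hom_eval₂, map_zero, show (fun i => h (c i)) = b from funext hc]
  exact hb p hp

end IsRealClosed

/-! ### Real fields without proper finite real extensions -/

section Semireal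

open Polynomial

theorem IsSemireal.eq_zero_of_mul_self_add_eq_zero {F : Type*} [Field F] [IsSemireal F] {a s : F}
    (hs : IsSumSq s) (h : a * a + s = 0) : a = 0 := by
  by_contra ha
  refine IsSemireal.not_isSumSq_neg_one F ?_
  rw [show (-1 : F) = s * (a⁻¹ * a⁻¹) by field_simp; linear_combination -h]
  exact hs.mul (IsSumSq.mul_self _)

theorem IsSumSq.even_natDegree_and_isSumSq_leadingCoeff {F : Type*} [Field F] [IsSemireal F]
    {S : F[X]} (hS : IsSumSq S) : Even S.natDegree ∧ IsSumSq S.leadingCoeff := by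
  induction hS with
  | zero => simp
  | @sq_add g S _ ih =>
    have hg : (g * g).natDegree = g.natDegree + g.natDegree := by
      rw [← pow_two, natDegree_pow, two_mul]
    have hgl : (g * g).leadingCoeff = g.leadingCoeff * g.leadingCoeff := leadingCoeff_mul g g
    rcases lt_trichotomy (g * g).natDegree S.natDegree with h | h | h
    · rw [natDegree_add_eq_right_of_natDegree_lt h, leadingCoeff_add_of_degree_lt
        (degree_lt_degree h)]
      exact ih
    · by_cases h0 : (g * g).leadingCoeff + S.leadingCoeff = 0
      · -- the leading coefficients cannot cancel, since `F` is real
        rw [hgl] at h0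
        have := IsSemireal.eq_zero_of_mul_self_add_eq_zero ih.2 h0
        rw [leadingCoeff_eq_zero] at this
        simpa [this] using ih
      · have hcoeff : (g * g + S).coeff S.natDegree = (g * g).leadingCoeff + S.leadingCoeff := by
          rw [coeff_add, leadingCoeff, leadingCoeff, h]
        have hdeg : (g * g + S).natDegree = S.natDegree := by
          refine natDegree_eq_of_le_of_coeff_ne_zero ?_ (by rwa [hcoeff])
          exact (natDegree_add_le _ _).trans (max_le h.le le_rfl)
        rw [leadingCoeff, hdeg, hcoeff, hgl]
        exact ⟨ih.1, (IsSumSq.mul_self _).add ih.2⟩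
    · rw [natDegree_add_eq_left_of_natDegree_lt h, leadingCoeff_add_of_degree_lt'
        (degree_lt_degree h), hg, hgl]
      exact ⟨⟨_, rfl⟩, IsSumSq.mul_self _⟩

theorem IsSumSq.exists_natDegree_le_adjoinRoot {F : Type*} [Field F] {p : F[X]} (hp : p.Monic)
    (hp1 : p ≠ 1) {t : AdjoinRoot p} (ht : IsSumSq t) :
    ∃ S : F[X], IsSumSq S ∧ S.natDegree ≤ 2 * (p.natDegree - 1) ∧ AdjoinRoot.mk p S = t := by
  induction ht with
  | zero => exact ⟨0, IsSumSq.zero, by simp, map_zero _⟩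
  | sq_add a _ ih =>
    obtain ⟨S, hS, hdeg, rfl⟩ := ih
    obtain ⟨g, rfl⟩ := AdjoinRoot.mk_surjective a
    have hg : AdjoinRoot.mk p (g %ₘ p) = AdjoinRoot.mk p g := by
      conv_rhs => rw [← modByMonic_add_div g p, map_add, map_mul, AdjoinRoot.mk_self, zero_mul,
        add_zero]
    refine ⟨(g %ₘ p) * (g %ₘ p) + S, hS.sq_add _, ?_, by rw [map_add, map_mul, hg]⟩
    have h1 := natDegree_modByMonic_lt g hp hp1
    refine (natDegree_add_le _ _).trans (max_le ?_ hdeg)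
    rw [← pow_two, natDegree_pow]
    omega

/-- If `F[X] / (p)` is not real, some polynomial `1 + S`, where `S` is a sum of squares of
polynomials of degree less than `deg p`, is a multiple of `p`. -/
theorem exists_dvd_one_add_of_not_isSemireal {F : Type*} [Field F] {p : F[X]} (hp : p.Monic)
    (hp1 : p ≠ 1) (h : ¬ IsSemireal (AdjoinRoot p)) :
    ∃ S : F[X], IsSumSq S ∧ S.natDegree ≤ 2 * (p.natDegree - 1) ∧ p ∣ 1 + S := by
  rw [isSemireal_iff_not_isSumSq_neg_one, not_not] at h
  obtain ⟨S, hS, hdeg, hmk⟩ := h.exists_natDegree_le_adjoinRoot hp hp1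
  refine ⟨S, hS, hdeg, AdjoinRoot.mk_eq_zero.1 ?_⟩
  rw [map_add, hmk, map_one, add_neg_cancel]

theorem IsSumSq.one_add_ne_zero_polynomial {F : Type*} [Field F] [IsSemireal F] {S : F[X]}
    (hS : IsSumSq S) (x : F) : (1 + S).eval x ≠ 0 := by
  rw [eval_add, eval_one]
  exact IsSemireal.one_add_ne_zero (hS.map (evalRingHom x))

theorem isSumSq_neg_of_not_isSemireal_adjoinRoot {F : Type*} [Field F] [IsSemireal F] {a : F}
    (h : ¬ IsSemireal (AdjoinRoot (X ^ 2 - C a))) : IsSumSq (-a) := by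
  have hdeg : (X ^ 2 - C a : F[X]).natDegree = 2 := natDegree_X_pow_sub_C
  have hmonic : (X ^ 2 - C a : F[X]).Monic := monic_X_pow_sub_C a two_ne_zero
  obtain ⟨S, hS, hSdeg, q, hq⟩ := exists_dvd_one_add_of_not_isSemireal hmonic
    (by intro h1; simp [h1] at hdeg) h
  rw [hdeg] at hSdeg
  have hne : 1 + S ≠ 0 := fun h0 => hS.one_add_ne_zero_polynomial 0 (by simp [h0])
  have hq0 : q ≠ 0 := by rintro rfl; exact hne (by simpa using hq)
  have hqdeg : q.natDegree = 0 := by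
    have h1 : (1 + S).natDegree ≤ 2 :=
      (natDegree_add_le _ _).trans (max_le (by simp) hSdeg)
    rw [hq, natDegree_mul hmonic.ne_zero hq0, hdeg] at h1
    omega
  obtain ⟨c, rfl⟩ := natDegree_eq_zero.1 hqdeg
  have hc0 : c ≠ 0 := by rintro rfl; simp at hq0
  have h1S : IsSumSq (1 + S) := by simpa using hS.sq_add 1
  have hc : IsSumSq c := by
    have := h1S.even_natDegree_and_isSumSq_leadingCoeff.2
    rwa [hq, leadingCoeff_mul, hmonic.leadingCoeff, one_mul, leadingCoeff_C] at this
  have h0 : IsSumSq (-a * c) := by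
    have := h1S.map (evalRingHom (0 : F))
    rw [hq] at this
    simpa using this
  rw [show -a = (-a * c) * c * (c⁻¹ * c⁻¹) by field_simp]
  exact (h0.mul hc).mul (IsSumSq.mul_self _)

/-- A real field `F` is real closed if no irreducible polynomial without roots defines a real
extension of `F`. -/
theorem IsRealClosed.of_forall_adjoinRoot {F : Type*} [Field F] [IsSemireal F]
    (h : ∀ p : F[X], p.Monic → Irreducible p → IsSemireal (AdjoinRoot p) → ∃ x, p.IsRoot x) :
    IsRealClosed F where
  isSquare_or_isSquare_neg x := by
    have key (a : F) (ha : ¬ IsSquare a) : IsSumSq (-a) := by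
      refine isSumSq_neg_of_not_isSemireal_adjoinRoot fun hreal => ha ?_
      have hroot (y : F) (hy : (X ^ 2 - C a).IsRoot y) : IsSquare a :=
        ⟨y, by simp only [IsRoot.def, eval_sub, eval_pow, eval_X, eval_C] at hy
               linear_combination -hy⟩
      by_contra ha'
      obtain ⟨y, hy⟩ := h (X ^ 2 - C a) (monic_X_pow_sub_C a two_ne_zero)
        (irreducible_of_degree_le_three_of_not_isRoot (by simp)
          fun y hy => ha' (hroot y hy)) hreal
      exact ha' (hroot y hy)
    by_contra! hx
    -- otherwise both `x` and `-x` would be nonzero sums of squares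
    have h1 := key x hx.1
    have h2 := key (-x) hx.2
    rw [neg_neg] at h2
    have hx0 : x ≠ 0 := by rintro rfl; simp at hx
    refine IsSemireal.not_isSumSq_neg_one F ?_
    rw [show (-1 : F) = -x * x * (x⁻¹ * x⁻¹) by field_simp]
    exact (h1.mul h2).mul (IsSumSq.mul_self _)
  exists_isRoot_of_odd_natDegree {f} hf := by
    induction hn : f.natDegree using Nat.strong_induction_on generalizing f with
    | _ n ih =>
      have hf0 : f ≠ 0 := by rintro rfl; simp at hf
      by_cases hirr : Irreducible f
      · have hlc : IsUnit (C f.leadingCoeff⁻¹) := by simpa using hf0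
        set p := f * C f.leadingCoeff⁻¹ with hp
        have hmonic : p.Monic := monic_mul_leadingCoeff_inv hf0
        have hpdeg : p.natDegree = n := by
          rw [hp, natDegree_mul_C (by simpa using hf0), hn]
        have hroot (y : F) (hy : p.IsRoot y) : f.IsRoot y := by
          rw [hp, IsRoot.def, eval_mul, eval_C] at hy
          exact (mul_eq_zero.1 hy).resolve_right (by simpa using hf0)
        by_cases hreal : IsSemireal (AdjoinRoot p)
        · obtain ⟨y, hy⟩ := h p hmonic
            ((irreducible_mul_isUnit hlc).2 hirr) hreal
          exact ⟨y, hroot y hy⟩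
        -- otherwise `p` divides `1 + S` with a cofactor `q` of smaller odd degree, which has a
        -- root by induction; but `1 + S` has no root
        exfalso
        rw [hn] at hf
        obtain ⟨S, hS, hSdeg, q, hq⟩ := exists_dvd_one_add_of_not_isSemireal hmonic
          (by intro h1; rw [h1] at hpdeg; simp at hpdeg; subst hpdeg; simp at hf) hreal
        have hne : 1 + S ≠ 0 := fun h0 => hS.one_add_ne_zero_polynomial 0 (by simp [h0])
        have hq0 : q ≠ 0 := by rintro rfl; exact hne (by simpa using hq)
        have h1S : IsSumSq (1 + S) := by simpa using hS.sq_add 1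
        have heven := h1S.even_natDegree_and_isSumSq_leadingCoeff.1
        have hle : (1 + S).natDegree ≤ 2 * (n - 1) :=
          (natDegree_add_le _ _).trans (max_le (by simp) (hpdeg ▸ hSdeg))
        rw [hq, natDegree_mul hmonic.ne_zero hq0, hpdeg] at heven hle
        obtain ⟨y, hy⟩ := ih q.natDegree (by have := hf.pos; omega)
          ((Nat.even_add.1 heven).not.1 (Nat.not_even_iff_odd.2 hf) |> Nat.not_even_iff_odd.1) rfl
        refine hS.one_add_ne_zero_polynomial y ?_
        rw [hq, eval_mul, hy.eq_zero, mul_zero]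
      · have hunit : ¬ IsUnit f := fun hu => by
          rw [natDegree_eq_zero_of_isUnit hu] at hf
          simp at hf
        rw [irreducible_iff, not_and] at hirr
        have := hirr hunit
        push Not at this
        obtain ⟨g₁, g₂, rfl, h1, h2⟩ := this
        have hg1 := left_ne_zero_of_mul hf0
        have hg2 := right_ne_zero_of_mul hf0
        rw [natDegree_mul hg1 hg2] at hn hf
        have hpos {g : F[X]} (hg : g ≠ 0) (hu : ¬ IsUnit g) : 0 < g.natDegree :=
          natDegree_pos_iff_degree_pos.2 (degree_pos_of_ne_zero_of_nonunit hg hu)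
        have := hpos hg1 h1
        have := hpos hg2 h2
        rcases Nat.even_or_odd g₁.natDegree with he | ho
        · obtain ⟨y, hy⟩ := ih g₂.natDegree (by omega)
            ((Nat.odd_add'.1 hf).2 he) rfl
          exact ⟨y, root_mul_left_of_isRoot _ hy⟩
        · obtain ⟨y, hy⟩ := ih g₁.natDegree (by omega) ho rfl
          exact ⟨y, root_mul_right_of_isRoot _ hy⟩

/-! ### Real closed extensions -/

theorem isSemireal_fieldRange {E Ω : Type*} [Field E] [IsSemireal E] [Field Ω] (f : E →+* Ω) :
    IsSemireal f.fieldRange :=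
  isSemireal_of_ringHom f.rangeRestrictFieldEquiv.symm.toRingHom

theorem isSemireal_sSup {Ω : Type*} [Field Ω] {c : Set (Subfield Ω)} (hne : c.Nonempty)
    (hc : IsChain (· ≤ ·) c) (h : ∀ M ∈ c, IsSemireal M) : IsSemireal (sSup c : Subfield Ω) := by
  have key (s : (sSup c : Subfield Ω)) (hs : IsSumSq s) :
      ∃ M ∈ c, ∃ t : M, IsSumSq t ∧ (t : Ω) = s := by
    induction hs with
    | zero => exact ⟨_, hne.some_mem, 0, IsSumSq.zero, rfl⟩
    | sq_add a _ ih =>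
      obtain ⟨M, hM, t, ht, hts⟩ := ih
      obtain ⟨M', hM', ha⟩ := (Subfield.mem_sSup_of_directedOn hne hc.directedOn).1 a.2
      obtain ⟨M'', hM'', h1, h2⟩ := hc.directedOn M hM M' hM'
      exact ⟨M'', hM'', _, (ht.map (Subfield.inclusion h1)).sq_add ⟨a, h2 ha⟩, by
        rw [AddMemClass.coe_add, AddMemClass.coe_add, ← hts]
        rfl⟩
  refine IsSemireal.of_not_isSumSq_neg_one fun h1 => ?_
  obtain ⟨M, hM, t, ht, hts⟩ := key _ h1
  have := h M hM
  refine IsSemireal.not_isSumSq_neg_one M ?_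
  rwa [show (-1 : M) = t from Subtype.ext (by simp [hts])]

/-- Every real field embeds into a real closed field: a maximal real subfield of an algebraic
closure is real closed. -/
theorem exists_ringHom_isRealClosed_of_field (F : Type u) [Field F] [IsSemireal F] :
    ∃ (R : Type u) (_ : Field R), IsRealClosed R ∧ Nonempty (F →+* R) := by
  let Ω := AlgebraicClosure F
  obtain ⟨M, hFM, hM⟩ := zorn_le_nonempty₀ {M : Subfield Ω | IsSemireal M}
    (fun c hcs hc M hM => ⟨sSup c, isSemireal_sSup ⟨M, hM⟩ hc hcs, fun _ => le_sSup⟩)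
    (algebraMap F Ω).fieldRange (isSemireal_fieldRange _)
  have hreal : IsSemireal M := hM.prop
  refine ⟨M, inferInstance, IsRealClosed.of_forall_adjoinRoot fun p hp hirr hp' => ?_,
    ⟨(Subfield.inclusion hFM).comp (algebraMap F Ω).rangeRestrictField⟩⟩
  have := Fact.mk hirr
  obtain ⟨y, hy⟩ := IsAlgClosed.exists_aeval_eq_zero Ω p hirr.degree_pos.ne'
  let g : AdjoinRoot p →+* Ω := AdjoinRoot.lift (algebraMap M Ω) y hy
  have hle : M ≤ g.fieldRange := fun x hx => ⟨AdjoinRoot.of p ⟨x, hx⟩, AdjoinRoot.lift_of hy⟩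
  have hyM : y ∈ M := hM.le_of_ge (isSemireal_fieldRange g) hle
    ⟨AdjoinRoot.root p, AdjoinRoot.lift_root hy⟩
  refine ⟨⟨y, hyM⟩, (algebraMap M Ω).injective ?_⟩
  rw [map_zero, ← hy]
  exact (aeval_algebraMap_apply Ω (⟨y, hyM⟩ : M) p).symm

end Semireal

section Preordering

/-- A preordering that is maximal is an ordering. -/
theorem RingPreordering.isOrdering_of_isMax {A : Type*} [CommRing A] {P : RingPreordering A}
    (hP : IsMax P) : P.IsOrdering := by
  -- if `a` is not in `P`, then `P + a P` contains `-1`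
  have key (a : A) (ha : a ∉ P) : ∃ p ∈ P, ∃ q ∈ P, -1 = p + a * q := by
    by_contra! hcon
    let Q : RingPreordering A := RingPreordering.mk' {x | ∃ p ∈ P, ∃ q ∈ P, x = p + a * q}
      (by
        rintro _ _ ⟨p, hp, q, hq, rfl⟩ ⟨p', hp', q', hq', rfl⟩
        exact ⟨p + p', add_mem hp hp', q + q', add_mem hq hq', by ring⟩)
      (by
        rintro _ _ ⟨p, hp, q, hq, rfl⟩ ⟨p', hp', q', hq', rfl⟩
        exact ⟨p * p' + a * a * (q * q'), add_mem (mul_mem hp hp')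
          (mul_mem (P.mul_self_mem a) (mul_mem hq hq')), p * q' + q * p',
          add_mem (mul_mem hp hq') (mul_mem hq hp'), by ring⟩)
      (fun x => ⟨x * x, P.mul_self_mem x, 0, zero_mem P, by ring⟩)
      (by rintro ⟨p, hp, q, hq, h⟩; exact hcon p hp q hq h)
    have hPQ : P ≤ Q := fun x hx => ⟨x, hx, 0, zero_mem P, by ring⟩
    exact ha (hP hPQ ⟨0, zero_mem P, 1, one_mem P, by ring⟩)
  rw [RingPreordering.isOrdering_iff]
  intro a b hab
  by_contra! h
  obtain ⟨p, hp, q, hq, h1⟩ := key a h.1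
  obtain ⟨p', hp', q', hq', h2⟩ := key b h.2
  refine P.neg_one_notMem ?_
  rw [show (-1 : A) = p + p' + p * p' + -(a * b) * (q * q') by
    linear_combination (1 + p') * h1 - a * q * h2]
  exact add_mem (add_mem (add_mem hp hp') (mul_mem hp hp')) (mul_mem hab (mul_mem hq hq'))

theorem exists_isOrdering (A : Type*) [CommRing A] [IsSemireal A] :
    ∃ P : RingPreordering A, P.IsOrdering := by
  let P₀ : RingPreordering A := RingPreordering.mk' {x | IsSumSq x} (fun hx hy => hx.add hy)
    (fun hx hy => hx.mul hy) IsSumSq.mul_self (IsSemireal.not_isSumSq_neg_one A)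
  have : Nonempty (RingPreordering A) := ⟨P₀⟩
  obtain ⟨P, hP⟩ := zorn_le_nonempty (α := RingPreordering A) fun c hc hne => by
    refine ⟨RingPreordering.mk' {x | ∃ P ∈ c, x ∈ P} ?_ ?_ ?_ ?_, fun P hP x hx => ⟨P, hP, hx⟩⟩
    · rintro x y ⟨P, hP, hx⟩ ⟨Q, hQ, hy⟩
      obtain ⟨T, hT, h1, h2⟩ := hc.directedOn P hP Q hQ
      exact ⟨T, hT, add_mem (h1 hx) (h2 hy)⟩
    · rintro x y ⟨P, hP, hx⟩ ⟨Q, hQ, hy⟩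
      obtain ⟨T, hT, h1, h2⟩ := hc.directedOn P hP Q hQ
      exact ⟨T, hT, mul_mem (h1 hx) (h2 hy)⟩
    · exact fun x => ⟨_, hne.some_mem, RingPreordering.mul_self_mem _ x⟩
    · rintro ⟨P, -, h⟩
      exact P.neg_one_notMem h
  exact ⟨P, RingPreordering.isOrdering_of_isMax hP⟩

/-- The residue field of the support of an ordering is a real field. -/
theorem RingPreordering.IsOrdering.isSemireal_fractionRing {A : Type*} [CommRing A]
    (P : RingPreordering A) [P.IsOrdering] : IsSemireal (FractionRing (A ⧸ P.support)) := by
  let f : A →+* FractionRing (A ⧸ P.support) :=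
    (algebraMap (A ⧸ P.support) _).comp (Ideal.Quotient.mk P.support)
  have hf (x : A) : f x = 0 ↔ x ∈ P.support := by
    rw [RingHom.comp_apply, FaithfulSMul.algebraMap_eq_zero_iff, Ideal.Quotient.eq_zero_iff_mem]
  have key (s : FractionRing (A ⧸ P.support)) (hs : IsSumSq s) :
      ∃ d ∉ P.support, ∃ t ∈ P, s * f d * f d = f t := by
    induction hs with
    | zero => exact ⟨1, P.one_notMem_support, 0, zero_mem P, by simp⟩
    | sq_add a _ ih =>
      obtain ⟨d, hd, t, ht, h⟩ := ih
      obtain ⟨n, m, hm, rfl⟩ := IsFractionRing.div_surjective (A := A ⧸ P.support) a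
      obtain ⟨n, rfl⟩ := Ideal.Quotient.mk_surjective n
      obtain ⟨m, rfl⟩ := Ideal.Quotient.mk_surjective m
      have hm' : m ∉ P.support := fun h =>
        nonZeroDivisors.ne_zero hm (Ideal.Quotient.eq_zero_iff_mem.2 h)
      have hfm : f m ≠ 0 := (hf m).not.2 hm'
      refine ⟨d * m, fun h => (Ideal.IsPrime.mem_or_mem inferInstance h).elim hd hm',
        (n * d) * (n * d) + m * m * t,
        add_mem (P.mul_self_mem _) (mul_mem (P.mul_self_mem _) ht), ?_⟩
      change (f n / f m * (f n / f m) + _) * _ * _ = _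
      simp only [map_add, map_mul, ← h]
      field_simp
  refine IsSemireal.of_not_isSumSq_neg_one fun h1 => ?_
  obtain ⟨d, hd, t, ht, h⟩ := key _ h1
  have hmem : d * d + t ∈ P.support := by
    rw [← hf, map_add, map_mul, ← h]
    ring
  have hneg : -(d * d) ∈ P := by
    rw [show -(d * d) = -(d * d + t) + t by ring]
    exact add_mem (RingPreordering.mem_support.1 hmem).2 ht
  have := Ideal.IsPrime.mem_or_mem (I := P.support) inferInstance
    (RingPreordering.mem_support.2 ⟨P.mul_self_mem d, hneg⟩)
  exact this.elim hd hd

/-- Every ring in which `-1` is not a sum of squares has a homomorphism to a real closed field. -/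
theorem exists_ringHom_isRealClosed (A : Type u) [CommRing A] [IsSemireal A] :
    ∃ (R : Type u) (_ : Field R), IsRealClosed R ∧ Nonempty (A →+* R) := by
  obtain ⟨P, hP⟩ := exists_isOrdering A
  have := RingPreordering.IsOrdering.isSemireal_fractionRing P
  obtain ⟨R, _, hR, ⟨g⟩⟩ := exists_ringHom_isRealClosed_of_field (FractionRing (A ⧸ P.support))
  exact ⟨R, _, hR, ⟨g.comp ((algebraMap (A ⧸ P.support) _).comp (Ideal.Quotient.mk P.support))⟩⟩

end Preordering

/-! ### Existentially closed rings -/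

/-- A homomorphism from a real closed field to a pre-real ring is existentially closed. -/
theorem IsRealClosed.isExistentiallyClosedHom_of_isSemireal {k B : Type u} [Field k]
    [IsRealClosed k] [CommRing B] [IsSemireal B] (f : k →+* B) : IsExistentiallyClosedHom f := by
  obtain ⟨R, _, _, ⟨g⟩⟩ := exists_ringHom_isRealClosed B
  exact (IsRealClosed.isExistentiallyClosedHom (g.comp f)).of_comp

theorem MvPolynomial.eval₂_aeval_X {A B : Type*} [CommRing A] [CommRing B] {n : ℕ} {i : Fin n}
    (p : Polynomial A) (f : A →+* B) (b : Fin n → B) :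
    MvPolynomial.eval₂ f b (Polynomial.aeval (MvPolynomial.X i) p) = p.eval₂ f (b i) := by
  change MvPolynomial.eval₂Hom f b _ = _
  rw [Polynomial.aeval_def, Polynomial.hom_eval₂]
  congr 1
  · ext; simp
  · simp

theorem IsExistentiallyClosedHom.exists_isRoot {A B : Type*} [CommRing A] [CommRing B]
    {f : A →+* B} (hf : IsExistentiallyClosedHom f) (p : Polynomial A) {b : B}
    (hb : p.eval₂ f b = 0) : ∃ a, p.IsRoot a := by
  let P : MvPolynomial (Fin 1) A := Polynomial.aeval (MvPolynomial.X 0) p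
  obtain ⟨a, ha⟩ := hf 1 (Ideal.span {P}) (Submodule.fg_span_singleton P)
    ⟨fun _ => b, by
      simp [mem_zerosThrough_span_iff, P, MvPolynomial.eval₂_aeval_X, hb]⟩
  rw [mem_zerosThrough_span_iff] at ha
  exact ⟨a 0, (p.eval₂_id ▸ MvPolynomial.eval₂_aeval_X p (RingHom.id A) a).symm.trans (ha P rfl)⟩

/-- A ring with an existentially closed homomorphism to a field is a field. -/
theorem IsExistentiallyClosedHom.isField {A B : Type*} [CommRing A] [Field B]
    {f : A →+* B} (hf : IsExistentiallyClosedHom f) : IsField A where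
  exists_pair_ne := ⟨0, 1, fun h => zero_ne_one (α := B) (by rw [← map_zero f, h, map_one])⟩
  mul_comm := mul_comm
  mul_inv_cancel {a} ha := by
    have hfa : f a ≠ 0 := fun h => ha (by
      obtain ⟨c, hc⟩ := hf.exists_isRoot (Polynomial.C a) (b := 0) (by simp [h])
      simpa using hc)
    obtain ⟨c, hc⟩ := hf.exists_isRoot (Polynomial.C a * Polynomial.X - 1) (b := (f a)⁻¹)
      (by simp [hfa])
    exact ⟨c, sub_eq_zero.1 (by simpa using hc)⟩

theorem isRealClosedField_of_isExistentiallyClosedIn {A : Type u} [CommRing A]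
    (h : IsExistentiallyClosedIn (fun B [CommRing B] => IsRealField B) A) :
    IsRealClosedField A := by
  refine ⟨h.mem.1, ?_⟩
  let : Field A := h.mem.1.toField
  have : IsSemireal A := IsSemireal.of_not_isSumSq_neg_one h.mem.2
  refine IsRealClosed.of_forall_adjoinRoot fun p _ hirr hreal => ?_
  have := Fact.mk hirr
  exact (h.isExistentiallyClosedHom (AdjoinRoot p)
    ⟨Field.toIsField _, IsSemireal.not_isSumSq_neg_one _⟩ (AdjoinRoot.of p)).exists_isRoot p
      (AdjoinRoot.eval₂_root p)

theorem IsRealClosedField.isExistentiallyClosedIn_isPreRealRing {A : Type u} [CommRing A]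
    (h : IsRealClosedField A) :
    IsExistentiallyClosedIn (fun B [CommRing B] => IsPreRealRing B) A := by
  obtain ⟨hA, hR⟩ := h
  let : Field A := hA.toField
  refine ⟨IsSemireal.not_isSumSq_neg_one A, fun B _ hB f => ?_⟩
  have : IsSemireal B := IsSemireal.of_not_isSumSq_neg_one hB
  exact IsRealClosed.isExistentiallyClosedHom_of_isSemireal f

theorem IsExistentiallyClosedIn.isField_of_isPreRealRing {A : Type u} [CommRing A]
    (h : IsExistentiallyClosedIn (fun B [CommRing B] => IsPreRealRing B) A) : IsField A := by
  have : IsSemireal A := IsSemireal.of_not_isSumSq_neg_one h.mem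
  obtain ⟨R, _, _, ⟨f⟩⟩ := exists_ringHom_isRealClosed A
  exact (h.isExistentiallyClosedHom R (IsSemireal.not_isSumSq_neg_one R) f).isField

theorem IsExistentiallyClosedIn.isRealField_of_isPreRealRing {A : Type u} [CommRing A]
    (h : IsExistentiallyClosedIn (fun B [CommRing B] => IsPreRealRing B) A) (hA : IsField A) :
    IsExistentiallyClosedIn (fun B [CommRing B] => IsRealField B) A :=
  ⟨⟨hA, h.mem⟩, fun B _ hB f => h.isExistentiallyClosedHom B hB.2 f⟩

theorem mainTheorem9 (A : Type*) [CommRing A] :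
    (IsExistentiallyClosedIn (fun B [CommRing B] => IsPreRealRing B) A ↔ IsRealClosedField A) ∧
      (IsRealClosedField A ↔ IsExistentiallyClosedIn (fun B [CommRing B] => IsRealField B) A) := by
  refine ⟨⟨fun h => ?_, IsRealClosedField.isExistentiallyClosedIn_isPreRealRing⟩, fun h => ?_,
    isRealClosedField_of_isExistentiallyClosedIn⟩
  · exact isRealClosedField_of_isExistentiallyClosedIn
      (h.isRealField_of_isPreRealRing h.isField_of_isPreRealRing)
  · exact h.isExistentiallyClosedIn_isPreRealRing.isRealField_of_isPreRealRing h.1
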